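/- Let $q$ be a prime power, $k\le n\le m$, and let $g_1,\dots,g_n\in\mathbb{F}_{q^m}$ be linearly independent over $\mathbb{F}_q$. Let $Gab_k(g)\subseteq\mathbb{F}_{q^m}^n$ be the Gabidulin code, i.e. the row space of the matrix $(g_j^{q^i})_{0\le i<k,\,1\le j\le n}$, and let $\mathrm{rank}$ denote the $\mathbb{F}_q$-dimension of the span of the entries of a vector. Let $w$ be an integer with $\frac{n-k}{2}<w\le n-k$, put $\xi=w-\frac{n-k}{2}$, and let $\delta\in[2\xi,n-k]$ be an integer. Let $\mathrm{Dec}$ be an error-erasure decoder: on input $r\in\mathbb{F}_{q^m}^n$ and a full-rank matrix $B_C\in\mathbb{F}_q^{\delta\times n}$ it returns the (unique) codeword $c\in Gab_k(g)$ such that $r-c=a_CB_C+a_EB_E$ for some $a_C\in\mathbb{F}_{q^m}^\delta$, $a_E\in\mathbb{F}_{q^m}^t$, $B_E\in\mathbb{F}_q^{t\times n}$ with $2t+\delta\le n-k$, and it reports a failure if there is no such $c$. Each run of $\mathrm{Dec}$ is counted with (at least) $n^2$ operations over $\mathbb{F}_{q^m}$. The column-erasure-aided randomized decoder repeats the following: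 choose a $\delta$-dimensional subspace $\mathcal U$ of $\mathbb{F}_q^n$ uniformly at random, independently of everything before, take a full-rank matrix $B_C$ with row space $\mathcal U$, and compute $\hat c=\mathrm{Dec}(r,B_C)$; if $\mathrm{Dec}$ does not fail and $\mathrm{rank}(r-\hat c)\le w$, output $\hat c$ and stop. It may be given a maximum number $N_{\max}$ of iterations, after which it stops with a failure. Let $r$ be uniformly distributed on $\mathbb{F}_{q^m}^n$. Then the randomized decoder requires on average at least $$\mathcal W_{RD}=\min_{\delta'\in[2\xi,n-k]}\frac{n^2}{\sum_{j=0}^{w}\bar A_jP_{n,k,\delta',j}}$$ operations over $\mathbb{F}_{q^m}$ to output a codeword $c\in Gab_k(g)$ with $\mathrm{rank}(r-c)\le w$. Here the minimum is over integers $\delta'$, $$\bar A_j=q^{m(k-n)}\prod_{i=0}^{j-1}\frac{(q^m-q^i)(q^n-q^i)}{q^j-q^i},\qquad P_{n,k,\delta,j}=\frac{S_{\delta,j}}{\binom{n}{\delta}_q}\ \text{ if } 2j+\delta>n-k,\qquad P_{n,k,\delta,j}=1\ \text{ otherwise},$$ $$S_{\delta,j}=\sum_{i=\lceil j-\frac{n-k}{2}+\frac{\delta}{2}\rceil}^{\min\{\delta,j\}}\binom{n-j}{\delta-i}_q\binom{j}{i}_q\,q^{(j-i)(\delta-i)}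 ,$$ with Gaussian binomials $\binom{a}{b}_q=\prod_{i=0}^{b-1}\frac{q^a-q^i}{q^b-q^i}$. Precisely: without a limit on the number of iterations, the expected number of operations (over $r$ and the guesses; possibly $\infty$) is at least $\mathcal W_{RD}$; and for every limit $N_{\max}$, the expected number of operations is at least $\mathcal W_{RD}$ times the probability that such a codeword is output. Moreover, $$\mathcal W_{RD}=\min_{\delta'\in[2\xi,n-k]}\frac{n^2\binom{n}{\delta'}_q}{\binom{n}{\delta'}_q\displaystyle\sum_{j=0}^{\lfloor\frac{n-k-\delta'}{2}\rfloor}\bar A_j+\sum_{j=\lfloor\frac{n-k-\delta'}{2}\rfloor+1}^{w}\bar A_j\,S_{\delta',j}} .$$ -/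

import Mathlib

open MeasureTheory ProbabilityTheory
open scoped ENNReal

/-! ### Rank weight and Gabidulin codes -/

/-- The `F`-rank of a vector `a` over the extension field `K`: the `F`-dimension of the span of
its entries. -/
noncomputable def rankWeight (F : Type*) {K : Type*} [Field F] [Field K] [Algebra F K] {n : ℕ}
    (a : Fin n → K) : ℕ :=
  Module.finrank F (Submodule.span F (Set.range a))

/-- The `k × n` generator matrix with entries `g_j ^ (q ^ i)`. -/
def gabidulinMatrix {K : Type*} [Field K] (q k : ℕ) {n : ℕ} (g : Fin n → K) :
    Matrix (Fin k) (Fin n) K :=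
  Matrix.of fun i j => g j ^ q ^ (i : ℕ)

/-- The Gabidulin code `Gab_k(g)`: the row space of its generator matrix. -/
def gabidulinCode {K : Type*} [Field K] (q k : ℕ) {n : ℕ} (g : Fin n → K) :
    Submodule K (Fin n → K) :=
  Submodule.span K (Set.range (gabidulinMatrix q k g).row)

/-! ### The Grassmannian -/

/-- The set of `δ`-dimensional subspaces of `F ^ n`. -/
abbrev Grass (F : Type*) [Field F] (n δ : ℕ) : Type _ :=
  {U : Submodule F (Fin n → F) // Module.finrank F U = δ}

/-- Every set of subspaces is an event. -/
instance Grass.instMeasurableSpace (F : Type*) [Field F] (n δ : ℕ) :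
    MeasurableSpace (Grass F n δ) := ⊤

/-! ### Arithmetic computation trees: programs that count operations over the field `K` -/

/-- The operations over `K = 𝔽_{q^m}`; `frob` is `x ↦ x ^ q` (it ignores its second operand). -/
inductive FieldOp : Type
  | add | sub | mul | div | frob

/-- The result of a field operation. -/
def FieldOp.eval {K : Type*} [Field K] (q : ℕ) : FieldOp → K → K → K
  | add, x, y => x + y
  | sub, x, y => x - y
  | mul, x, y => x * y
  | div, x, y => x / y
  | frob, x, _ => x ^ q

/-- Arithmetic computation trees over `K` with registers indexed by `ρ`. A program stops with a
failure or by returning a vector of `n` register contents; it may load constants, apply a field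
operation to two registers, and branch on whether a register is zero. -/
inductive ArithTree (K : Type*) (ρ : Type) (n : ℕ)
  | fail : ArithTree K ρ n
  | output (out : Fin n → ρ) : ArithTree K ρ n
  | const (dst : ρ) (x : K) (next : ArithTree K ρ n) : ArithTree K ρ n
  | op (o : FieldOp) (dst a b : ρ) (next : ArithTree K ρ n) : ArithTree K ρ n
  | branch (a : ρ) (ifZero ifNonzero : ArithTree K ρ n) : ArithTree K ρ n

open Classical in
/-- Execution of a program from the register contents `s`: the output (`none` is a failure) and
the number of field operations that were carried out. -/
noncomputable def ArithTree.run {K : Type*} [Field K] {ρ : Type} {n : ℕ} (q : ℕ) :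
    ArithTree K ρ n → (ρ → K) → Option (Fin n → K) × ℕ
  | fail, _ => (none, 0)
  | output out, s => (some fun i => s (out i), 0)
  | const dst x next, s => next.run q (Function.update s dst x)
  | op o dst a b next, s =>
      let t := next.run q (Function.update s dst (o.eval q (s a) (s b)))
      (t.1, t.2 + 1)
  | branch a ifZero ifNonzero, s =>
      if s a = 0 then ifZero.run q s else ifNonzero.run q s

/-! ### Error-erasure decoders -/

/-- Registers of a decoder: the `n` entries of the received word, the `δ * n` entries of the
erasure matrix `B_C`, and an unlimited scratch memory. -/
abbrev DecReg (n δ : ℕ) : Type := (Fin n ⊕ (Fin δ × Fin n)) ⊕ ℕ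

/-- The initial register contents on input `(r, B_C)`; the scratch memory is zero. -/
def decInput {F K : Type*} [Field F] [Field K] [Algebra F K] {n δ : ℕ}
    (r : Fin n → K) (B : Matrix (Fin δ) (Fin n) F) : DecReg n δ → K
  | Sum.inl (Sum.inl j) => r j
  | Sum.inl (Sum.inr p) => algebraMap F K (B p.1 p.2)
  | Sum.inr _ => 0

/-- A call of the decoder `T` on input `(r, B_C)` without row erasures: result and operation
count. -/
noncomputable def decode {F K : Type*} [Field F] [Field K] [Algebra F K] {n δ : ℕ} (q : ℕ)
    (T : ArithTree K (DecReg n δ) n) (r : Fin n → K) (B : Matrix (Fin δ) (Fin n) F) :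
    Option (Fin n → K) × ℕ :=
  T.run q (decInput r B)

/-- The error `e` is made of the `δ` column erasures described by `B_C` and of `t` full rank
errors: `e = a_C B_C + a_E B_E` with `a_C ∈ K ^ δ`, `a_E ∈ K ^ t` and `B_E` a `t × n` matrix
over `F`. -/
def HasErasureDecomp {F K : Type*} [Field F] [Field K] [Algebra F K] {n δ : ℕ}
    (e : Fin n → K) (B : Matrix (Fin δ) (Fin n) F) (t : ℕ) : Prop :=
  ∃ (aC : Fin δ → K) (aE : Fin t → K) (BE : Matrix (Fin t) (Fin n) F),
    e = Matrix.vecMul aC (B.map (algebraMap F K)) + Matrix.vecMul aE (BE.map (algebraMap F K))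

/-- `T` is an error-erasure decoder for `Gab_k(g)` with `δ` column erasures: on a received word
`r` and a full-rank matrix `B_C` it returns the codeword `c` for which `r - c` consists of the
given erasures and of `t` errors with `2 t + δ ≤ n - k`, and a failure if there is no such
codeword. (There is at most one, as the minimum rank distance is `n - k + 1`.) -/
def IsErrorErasureDecoder (F : Type*) {K : Type*} [Field F] [Field K] [Algebra F K] {n δ : ℕ}
    (q k : ℕ) (g : Fin n → K) (T : ArithTree K (DecReg n δ) n) : Prop :=
  ∀ (r : Fin n → K) (B : Matrix (Fin δ) (Fin n) F), LinearIndependent F B.row →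
    ∀ c : Fin n → K, (decode q T r B).1 = some c ↔
      c ∈ gabidulinCode q k g ∧ ∃ t : ℕ, 2 * t + δ ≤ n - k ∧ HasErasureDecomp (r - c) B t

/-! ### The column-erasure-aided randomized decoder -/

/-- The randomized decoder on the received word `r`, with at most `N` iterations, where the
successive random guesses are `U 0, U 1, …`, and `B` selects a full-rank matrix with a given row
space. The result is the output (`none` is a failure) and the number of operations over `K`: those
of the calls of the decoder, and the `n` subtractions for each computation of `r - c`. (Sampling
and rank computations are linear algebra over `F`.) -/
noncomputable def randomizedDecoder {F K : Type*} [Field F] [Field K] [Algebra F K] {n δ : ℕ}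
    (q w : ℕ) (T : ArithTree K (DecReg n δ) n) (B : Grass F n δ → Matrix (Fin δ) (Fin n) F)
    (r : Fin n → K) : (N : ℕ) → (U : ℕ → Grass F n δ) → Option (Fin n → K) × ℕ
  | 0, _ => (none, 0)
  | N + 1, U =>
      let d := decode q T r (B (U 0))
      let rest := randomizedDecoder q w T B r N (fun i => U (i + 1))
      match d.1 with
      | none => (rest.1, d.2 + rest.2)
      | some c =>
          if rankWeight F (r - c) ≤ w then (some c, d.2 + n)
          else (rest.1, d.2 + n + rest.2)

/-- The number of operations of the randomized decoder without a limit on the number of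
iterations, i.e. when it runs until it outputs a codeword; it is `∞` if this never happens and
infinitely many operations are carried out. -/
noncomputable def unlimitedOps {F K : Type*} [Field F] [Field K] [Algebra F K] {n δ : ℕ}
    (q w : ℕ) (T : ArithTree K (DecReg n δ) n) (B : Grass F n δ → Matrix (Fin δ) (Fin n) F)
    (r : Fin n → K) (U : ℕ → Grass F n δ) : ℝ≥0∞ :=
  ⨆ N : ℕ, ((randomizedDecoder q w T B r N U).2 : ℝ≥0∞)

/-! ### The work factor -/

/-- The Gaussian binomial coefficient `[a choose b]_q`. -/
noncomputable def gaussBinom (q a b : ℕ) : ℝ :=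
  ∏ i ∈ Finset.range b, ((q : ℝ) ^ a - (q : ℝ) ^ i) / ((q : ℝ) ^ b - (q : ℝ) ^ i)

/-- `Ā_j = q^{m(k-n)} ∏_{i<j} (q^m - q^i)(q^n - q^i)/(q^j - q^i)`. -/
noncomputable def avgCount (q m n k j : ℕ) : ℝ :=
  (q : ℝ) ^ ((m : ℤ) * ((k : ℤ) - (n : ℤ))) *
    ∏ i ∈ Finset.range j,
      (((q : ℝ) ^ m - (q : ℝ) ^ i) * ((q : ℝ) ^ n - (q : ℝ) ^ i)) / ((q : ℝ) ^ j - (q : ℝ) ^ i)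

/-- `∑_{i = ⌈j - (n-k)/2 + δ/2⌉}^{min(δ, j)} [n-j choose δ-i]_q [j choose i]_q q^{(j-i)(δ-i)}`. -/
noncomputable def guessSum (q n k δ j : ℕ) : ℝ :=
  ∑ i ∈ Finset.Icc ⌈(j : ℝ) - ((n : ℝ) - (k : ℝ)) / 2 + (δ : ℝ) / 2⌉₊ (min δ j),
    gaussBinom q (n - j) (δ - i) * gaussBinom q j i * (q : ℝ) ^ ((j - i) * (δ - i))

/-- The probability `P_{n,k,δ,j}`. -/
noncomputable def guessProb (q n k δ j : ℕ) : ℝ :=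
  if n - k < 2 * j + δ then guessSum q n k δ j / gaussBinom q n δ else 1

/-- `W_RD = min_{δ ∈ [2ξ, n-k]} n² / ∑_{j=0}^w Ā_j P_{n,k,δ,j}`, where `2ξ = 2w - (n-k)`. (The
truncated subtractions are exact and the minimum is over a nonempty finite set whenever
`n - k < 2 w` and `w ≤ n - k`.) -/
noncomputable def workFactor (q m n k w : ℕ) : ℝ :=
  sInf ((fun δ : ℕ => (n : ℝ) ^ 2 /
      ∑ j ∈ Finset.range (w + 1), avgCount q m n k j * guessProb q n k δ j) ''
    Set.Icc (2 * w - (n - k)) (n - k))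

/-- The same quantity with the probabilities written out through Gaussian binomials. -/
noncomputable def workFactorExplicit (q m n k w : ℕ) : ℝ :=
  sInf ((fun δ : ℕ => (n : ℝ) ^ 2 * gaussBinom q n δ /
      (gaussBinom q n δ * ∑ j ∈ Finset.Icc 0 ((n - k - δ) / 2), avgCount q m n k j +
        ∑ j ∈ Finset.Icc ((n - k - δ) / 2 + 1) w, avgCount q m n k j * guessSum q n k δ j)) ''
    Set.Icc (2 * w - (n - k)) (n - k))

/-! Call a subspace `V` successful for a received word `x` if the iteration with guess `V` outputs a
codeword, and let `p x` be the proportion of successful subspaces. Two facts give the bound.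

Average of `p` (`average_successSet_le`): a successful pair `(x, V)` is determined by the output
`c`, the error `e = x - c` of rank at most `w`, and `V`. The row space of such an `e` must meet `V`
in dimension at least `j - (n-k)/2 + δ/2`, with `j` the rank of `e`. Counting codewords, errors of
rank `j` and subspaces meeting a given one in dimension `i` bounds the average by `b = ∑ Ā_j
P_{n,k,δ,j}`. Upper bounds suffice for these counts, so injections replace bijections; only the
total number of subspaces, a denominator, needs a lower bound.

Waiting time (`one_sub_avgFailure_le`): given `x`, the guesses are independent trials of success
probability `p x`. Within `N` trials the success probability is `p` times the expected number of
trials `∑_{i<N} (1-p)^i`. One factor increases with `p` and the other decreases, so by Chebyshev's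
sum inequality the average of the product is at most the product of the averages: P(success) ≤ `b` ·
E(trials). Each trial costs at least `n²`, and `W_RD ≤ n²/b`, which settles the limited decoder.
Without a limit, a finite expected cost forces the failure probability to tend to `0`, and `N → ∞`
gives the claim. -/

/-! ### Counting linearly independent families -/

/-- `∏_{i<d} (q^N - q^i)`, the number of linearly independent `d`-tuples in an `N`-dimensional
space over a field with `q` elements. -/
noncomputable def independentCount (q N d : ℕ) : ℝ :=
  ∏ i ∈ Finset.range d, ((q : ℝ) ^ N - (q : ℝ) ^ i)

theorem gaussBinom_eq_div (q a b : ℕ) :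
    gaussBinom q a b = independentCount q a b / independentCount q b b :=
  Finset.prod_div_distrib ..

theorem independentCount_pos {q N d : ℕ} (hq : 1 < q) (hd : d ≤ N) :
    0 < independentCount q N d := by
  refine Finset.prod_pos fun i hi => sub_pos.2 ?_
  exact pow_lt_pow_right₀ (by exact_mod_cast hq) ((Finset.mem_range.1 hi).trans_le hd)

theorem independentCount_nonneg {q : ℕ} (hq : 1 < q) (N d : ℕ) :
    0 ≤ independentCount q N d := by
  rcases le_or_gt d N with h | h
  · exact (independentCount_pos hq h).le
  · exact (Finset.prod_eq_zero (Finset.mem_range.2 h) (sub_self _)).ge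

theorem gaussBinom_nonneg {q : ℕ} (hq : 1 < q) (a b : ℕ) : 0 ≤ gaussBinom q a b := by
  rw [gaussBinom_eq_div]
  exact div_nonneg (independentCount_nonneg hq _ _) (independentCount_nonneg hq _ _)

theorem gaussBinom_pos {q a b : ℕ} (hq : 1 < q) (h : b ≤ a) : 0 < gaussBinom q a b := by
  rw [gaussBinom_eq_div]
  exact div_pos (independentCount_pos hq h) (independentCount_pos hq le_rfl)

section Counting

variable {F V W : Type*} [Field F] [Fintype F] [AddCommGroup V] [Module F V] [Finite V]
  [AddCommGroup W] [Module F W] [Finite W]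

theorem natCard_linearIndependent (d : ℕ) :
    (Nat.card {s : Fin d → V // LinearIndependent F s} : ℝ) =
      independentCount (Fintype.card F) (Module.finrank F V) d := by
  rcases le_or_gt d (Module.finrank F V) with h | h
  · rw [card_linearIndependent h, independentCount, Finset.prod_range, Nat.cast_prod]
    refine Finset.prod_congr rfl fun i _ => ?_
    rw [Nat.cast_sub (Nat.pow_le_pow_right Fintype.card_pos (i.2.le.trans h))]
    push_cast
    rfl
  · have : IsEmpty {s : Fin d → V // LinearIndependent F s} :=
      ⟨fun s => by have := s.2.fintype_card_le_finrank; simp at this; omega⟩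
    -- For `d` above the dimension the product contains the zero factor `i = finrank`.
    rw [Nat.card_of_isEmpty, independentCount,
      Finset.prod_eq_zero (Finset.mem_range.2 h) (sub_self _), Nat.cast_zero]

/-- Families whose image under `f` is linearly independent are linearly independent families in
the range together with a shift by the kernel. -/
noncomputable def familyEquivRangeProdKer (f : V →ₗ[F] W) (d : ℕ) :
    {y : Fin d → V // LinearIndependent F (f ∘ y)} ≃
      {z : Fin d → LinearMap.range f // LinearIndependent F z} × (Fin d → LinearMap.ker f) :=
  -- Any set-theoretic section of `f` onto its range will do; linearity is not needed.
  let s := Function.surjInv f.surjective_rangeRestrict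
  have hs : ∀ z, f.rangeRestrict (s z) = z := Function.surjInv_eq f.surjective_rangeRestrict
  have hs' : ∀ z, f (s z) = z := fun z => congrArg Subtype.val (hs z)
  { toFun := fun y => ⟨⟨f.rangeRestrict ∘ y.1,
        LinearIndependent.of_comp (LinearMap.range f).subtype y.2⟩,
      fun a => ⟨y.1 a - s (f.rangeRestrict (y.1 a)), by simp [hs']⟩⟩
    invFun := fun p => ⟨fun a => s (p.1.1 a) + p.2 a, by
      have : f ∘ (fun a => s (p.1.1 a) + (p.2 a : V)) = (LinearMap.range f).subtype ∘ p.1.1 := by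
        ext a; simp [hs']
      rw [this]
      exact p.1.2.map' _ (Submodule.ker_subtype _)⟩
    left_inv := fun y => by ext a; simp
    right_inv := fun p => by
      have h : ∀ a, f.rangeRestrict (s (p.1.1 a) + p.2 a) = p.1.1 a := fun a => by
        ext; simp [hs']
      refine Prod.ext (Subtype.ext (funext h)) (funext fun a => Subtype.ext ?_)
      change s (p.1.1 a) + (p.2 a : V) - s (f.rangeRestrict (s (p.1.1 a) + p.2 a)) = p.2 a
      rw [h]; abel }

/-- Pairs of a linearly independent `i`-tuple in the kernel of `f` and a `d`-tuple with linearly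
independent image. -/
abbrev AdaptedPair (f : V →ₗ[F] W) (i d : ℕ) : Type _ :=
  {x : Fin i → LinearMap.ker f // LinearIndependent F x} ×
    {y : Fin d → V // LinearIndependent F (f ∘ y)}

theorem natCard_adaptedPair (f : V →ₗ[F] W) (i d : ℕ) :
    (Nat.card (AdaptedPair f i d) : ℝ) =
      independentCount (Fintype.card F) (Module.finrank F (LinearMap.ker f)) i *
      (independentCount (Fintype.card F) (Module.finrank F (LinearMap.range f)) d *
        (Fintype.card F : ℝ) ^ (Module.finrank F (LinearMap.ker f) * d)) := by
  rw [Nat.card_prod, Nat.card_congr (familyEquivRangeProdKer f d), Nat.card_prod,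
    Nat.cast_mul, Nat.cast_mul, natCard_linearIndependent, natCard_linearIndependent,
    Nat.card_fun, Module.natCard_eq_pow_finrank (K := F) (V := LinearMap.ker f)]
  simp [pow_mul]

end Counting

/-! ### Bases adapted to the kernel of a map -/

section AdaptedPair

variable {F V W : Type*} [Field F] [AddCommGroup V] [Module F V] [AddCommGroup W] [Module F W]

/-- An adapted pair for the restriction of `f` to a subspace, seen in the whole space. -/
def AdaptedPair.ofRestrict (f : V →ₗ[F] W) (U : Submodule F V) {i d : ℕ}
    (p : AdaptedPair (f ∘ₗ U.subtype) i d) : AdaptedPair f i d :=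
  ⟨⟨fun a => ⟨((p.1.1 a : U) : V), LinearMap.mem_ker.1 (p.1.1 a).2⟩, by
      have h1 : LinearIndependent F fun a => (p.1.1 a : U) :=
        p.1.2.map' _ (Submodule.ker_subtype _)
      have h2 : LinearIndependent F fun a => ((p.1.1 a : U) : V) :=
        h1.map' _ (Submodule.ker_subtype _)
      exact LinearIndependent.of_comp (LinearMap.ker f).subtype h2⟩,
    ⟨fun a => (p.2.1 a : V), p.2.2⟩⟩

/-- The family formed by an adapted pair. -/
def AdaptedPair.family {f : V →ₗ[F] W} {i d : ℕ} (p : AdaptedPair f i d) : Fin i ⊕ Fin d → V :=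
  Sum.elim (fun a => (p.1.1 a : V)) p.2.1

theorem AdaptedPair.linearIndependent_family {f : V →ₗ[F] W} {i d : ℕ} (p : AdaptedPair f i d) :
    LinearIndependent F p.family := by
  refine p.1.2.sumElim_of_quotient p.2.1 ?_
  -- `f` factors through `V ⧸ ker f`, so independence of `f ∘ y` pulls back to the classes of `y`.
  refine LinearIndependent.of_comp ((LinearMap.ker f).liftQ f le_rfl) ?_
  exact p.2.2

theorem AdaptedPair.span_family_ofRestrict [FiniteDimensional F V] (f : V →ₗ[F] W)
    (U : Submodule F V) {i d : ℕ} (p : AdaptedPair (f ∘ₗ U.subtype) i d)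
    (h : Module.finrank F U = i + d) :
    Submodule.span F (Set.range (ofRestrict f U p).family) = U := by
  refine Submodule.eq_of_le_of_finrank_eq (Submodule.span_le.2 ?_) ?_
  · rintro _ ⟨a | a, rfl⟩
    · exact (p.1.1 a).1.2
    · exact (p.2.1 a).2
  · rw [finrank_span_eq_card (linearIndependent_family _), h]
    simp

theorem AdaptedPair.ofRestrict_injective (f : V →ₗ[F] W) (U : Submodule F V) (i d : ℕ) :
    Function.Injective (ofRestrict f U : AdaptedPair (f ∘ₗ U.subtype) i d → _) := by
  intro p p' h
  refine Prod.ext (Subtype.ext (funext fun a => Subtype.ext (Subtype.ext ?_)))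
    (Subtype.ext (funext fun a => Subtype.ext ?_))
  · exact congrArg (fun p : AdaptedPair f i d => (p.1.1 a : V)) h
  · exact congrArg (fun p : AdaptedPair f i d => (p.2.1 a : V)) h

end AdaptedPair

/-! ### Counting subspaces -/

section Grassmannian

variable {F : Type*} [Field F] [Fintype F] {n δ : ℕ}

/-- Every independent `δ`-tuple is a basis of its span, and each subspace has `independentCount q δ
δ` bases. This direction suffices, as the number of subspaces is a denominator. -/
theorem gaussBinom_le_natCard_grass :
    gaussBinom (Fintype.card F) n δ ≤ Nat.card (Grass F n δ) := by
  have hq : 1 < Fintype.card F := Fintype.one_lt_card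
  rw [gaussBinom_eq_div, div_le_iff₀ (independentCount_pos hq le_rfl)]
  have he := Nat.card_le_card_of_injective
    (fun s : {s : Fin δ → Fin n → F // LinearIndependent F s} =>
      (⟨⟨Submodule.span F (Set.range s.1), by rw [finrank_span_eq_card s.2, Fintype.card_fin]⟩,
      ⟨fun a => ⟨s.1 a, Submodule.subset_span ⟨a, rfl⟩⟩,
        LinearIndependent.of_comp (Submodule.subtype _) s.2⟩⟩ :
      Σ V : Grass F n δ, {s : Fin δ → V.1 // LinearIndependent F s}))
    (fun s t h => Subtype.ext (funext fun a =>
      congrArg (fun p : Σ V : Grass F n δ, {s : Fin δ → V.1 // LinearIndependent F s} =>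
        (p.2.1 a : Fin n → F)) h))
  have := Fintype.ofFinite (Grass F n δ)
  have he' : (Nat.card {s : Fin δ → Fin n → F // LinearIndependent F s} : ℝ) ≤
      (Nat.card (Σ V : Grass F n δ, {s : Fin δ → V.1 // LinearIndependent F s}) : ℕ) := by
    exact_mod_cast he
  rw [natCard_linearIndependent, Module.finrank_fin_fun, Nat.card_sigma, Nat.cast_sum] at he'
  refine he'.trans_eq ?_
  rw [Finset.sum_congr rfl fun V _ => by rw [natCard_linearIndependent, V.2]]
  simp [Nat.card_eq_fintype_card]

/-- The number of `δ`-dimensional subspaces meeting `E` in dimension `i`. -/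
theorem natCard_grass_inter_le (E : Submodule F (Fin n → F)) {i : ℕ} (hi : i ≤ δ)
    (hE : i ≤ Module.finrank F E) :
    (Nat.card {V : Grass F n δ // Module.finrank F (V.1 ⊓ E : Submodule F _) = i} : ℝ) ≤
      gaussBinom (Fintype.card F) (n - Module.finrank F E) (δ - i) *
        gaussBinom (Fintype.card F) (Module.finrank F E) i *
        (Fintype.card F : ℝ) ^ ((Module.finrank F E - i) * (δ - i)) := by
  have hq : 1 < Fintype.card F := Fintype.one_lt_card
  set q := Fintype.card F
  set j := Module.finrank F E
  let S := {V : Grass F n δ // Module.finrank F (V.1 ⊓ E : Submodule F _) = i}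
  have hker : ∀ V : S, Module.finrank F (LinearMap.ker (E.mkQ ∘ₗ V.1.1.subtype)) = i := by
    intro V
    rw [LinearMap.ker_comp, Submodule.ker_mkQ, ← Submodule.finrank_map_subtype_eq,
      Submodule.map_comap_subtype]
    exact V.2
  have hrange : ∀ V : S, Module.finrank F (LinearMap.range (E.mkQ ∘ₗ V.1.1.subtype)) = δ - i := by
    intro V
    have := LinearMap.finrank_range_add_finrank_ker (E.mkQ ∘ₗ V.1.1.subtype)
    rw [hker V, V.1.2] at this
    omega
  -- `V ⊓ E` is the kernel of `E.mkQ` on `V`, so all `V` in `S` have the same number of adapted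
  -- pairs. A pair spans its `V`, so different `V` use different pairs of the whole space; dividing
  -- the two counts bounds the number of `V`.
  let e : (Σ V : S, AdaptedPair (E.mkQ ∘ₗ V.1.1.subtype) i (δ - i)) →
      AdaptedPair E.mkQ i (δ - i) := fun p => AdaptedPair.ofRestrict E.mkQ p.1.1.1 p.2
  have hspan : ∀ p, Submodule.span F (Set.range (e p).family) = p.1.1.1 := fun p =>
    AdaptedPair.span_family_ofRestrict _ _ _ (by rw [p.1.1.2, Nat.add_sub_cancel' hi])
  have he : Function.Injective e := by
    rintro ⟨V, p⟩ ⟨V', p'⟩ h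
    obtain rfl : V = V' := by
      refine Subtype.ext (Subtype.ext ?_)
      rw [← hspan ⟨V, p⟩, ← hspan ⟨V', p'⟩, h]
    exact congrArg (Sigma.mk V) (AdaptedPair.ofRestrict_injective _ _ _ _ h)
  have := Fintype.ofFinite S
  have hcard : (Nat.card (Σ V : S, AdaptedPair (E.mkQ ∘ₗ V.1.1.subtype) i (δ - i)) : ℝ) ≤
      (Nat.card (AdaptedPair E.mkQ i (δ - i)) : ℕ) := by
    exact_mod_cast Nat.card_le_card_of_injective e he
  rw [Nat.card_sigma, Nat.cast_sum,
    Finset.sum_congr rfl fun V _ => by rw [natCard_adaptedPair, hker, hrange],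
    natCard_adaptedPair, Submodule.ker_mkQ, Submodule.range_mkQ, finrank_top,
    Finset.sum_const, Finset.card_univ, ← Nat.card_eq_fintype_card, nsmul_eq_mul] at hcard
  have hquot : Module.finrank F ((Fin n → F) ⧸ E) = n - j := by
    have := E.finrank_quotient_add_finrank
    rw [Module.finrank_fin_fun] at this
    omega
  rw [hquot] at hcard
  have p1 := independentCount_pos (q := q) hq (le_refl i)
  have p2 := independentCount_pos (q := q) hq (le_refl (δ - i))
  have p3 : (0 : ℝ) < (q : ℝ) ^ (i * (δ - i)) := by positivity
  rw [gaussBinom_eq_div, gaussBinom_eq_div]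
  -- Kernel shifts in the whole space number `q ^ (j (δ-i))`, those inside one `V` number `q ^ (i
  -- (δ-i))`; their ratio is the power in the bound.
  have hsplit : (q : ℝ) ^ (j * (δ - i)) = (q : ℝ) ^ ((j - i) * (δ - i)) * q ^ (i * (δ - i)) := by
    rw [← pow_add, ← add_mul, Nat.sub_add_cancel hE]
  have hpos : 0 < independentCount q i i *
      (independentCount q (δ - i) (δ - i) * (q : ℝ) ^ (i * (δ - i))) := by positivity
  refine (le_div_iff₀ hpos).2 hcard |>.trans_eq ?_
  change _ * (_ * (q : ℝ) ^ (j * (δ - i))) / _ = _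
  rw [hsplit]
  field_simp
  exact mul_comm _ _

theorem natCard_grass_le_inter_le (E : Submodule F (Fin n → F)) (a : ℕ) :
    (Nat.card {V : Grass F n δ // a ≤ Module.finrank F (V.1 ⊓ E : Submodule F _)} : ℝ) ≤
      ∑ i ∈ Finset.Icc a (min δ (Module.finrank F E)),
        gaussBinom (Fintype.card F) (n - Module.finrank F E) (δ - i) *
        gaussBinom (Fintype.card F) (Module.finrank F E) i *
        (Fintype.card F : ℝ) ^ ((Module.finrank F E - i) * (δ - i)) := by
  classical
  have hfin := Fintype.ofFinite (Grass F n δ)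
  have h : (Nat.card {V : Grass F n δ // a ≤ Module.finrank F (V.1 ⊓ E : Submodule F _)} : ℝ) ≤
      ∑ i ∈ Finset.Icc a (min δ (Module.finrank F E)),
        (Nat.card {V : Grass F n δ // Module.finrank F (V.1 ⊓ E : Submodule F _) = i} : ℝ) := by
    simp only [Nat.card_eq_fintype_card, Fintype.card_subtype]
    rw [← Nat.cast_sum, Nat.cast_le]
    refine (Finset.card_le_card fun V hV => ?_).trans Finset.card_biUnion_le
    simp only [Finset.mem_filter, Finset.mem_univ, true_and, Finset.mem_biUnion,
      Finset.mem_Icc] at hV ⊢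
    exact ⟨_, ⟨hV, le_min ((Submodule.finrank_mono inf_le_left).trans_eq V.2)
      (Submodule.finrank_mono inf_le_right)⟩, rfl⟩
  refine h.trans (Finset.sum_le_sum fun i hi => ?_)
  rw [Finset.mem_Icc, le_min_iff] at hi
  exact natCard_grass_inter_le E hi.2.1 hi.2.2

end Grassmannian

/-! ### Row spaces and words of given rank -/

section RankWeight

variable {F K : Type*} [Field F] [Field K] [Algebra F K] {n : ℕ}

/-- The map that applies a linear form to all entries of `e`. -/
def rowForm (e : Fin n → K) : Module.Dual F K →ₗ[F] (Fin n → F) :=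
  LinearMap.pi fun i => LinearMap.applyₗ (e i)

theorem rowForm_apply (e : Fin n → K) (φ : Module.Dual F K) (i : Fin n) :
    rowForm e φ i = φ (e i) := rfl

/-- Row rank equals column rank: `rowForm e` is the transpose of `c ↦ ∑ c_i e_i`, whose range is the
span of the entries. -/
theorem finrank_range_rowForm [FiniteDimensional F K] (e : Fin n → K) :
    Module.finrank F (LinearMap.range (rowForm (F := F) e)) = rankWeight F e := by
  have h : rowForm (F := F) e =
      ((Pi.basisFun F (Fin n)).constr F).symm.toLinearMap ∘ₗ
        (Fintype.linearCombination F e).dualMap := by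
    ext φ i
    simp [rowForm_apply, Module.Basis.constr]
  rw [h, LinearMap.range_comp, LinearEquiv.finrank_map_eq,
    LinearMap.finrank_range_dualMap_eq_finrank_range, Fintype.range_linearCombination]
  rfl

/-- An error that consists of the erasures in the row space of `B` and of `t` errors has a row
space that meets the row space of `B` in codimension at most `t`. -/
theorem HasErasureDecomp.rankWeight_le [FiniteDimensional F K] {δ t : ℕ} {e : Fin n → K}
    {B : Matrix (Fin δ) (Fin n) F} (h : HasErasureDecomp e B t) :
    rankWeight F e ≤ Module.finrank F
      (Submodule.span F (Set.range B.row) ⊓ LinearMap.range (rowForm (F := F) e) :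
        Submodule F (Fin n → F)) + t := by
  obtain ⟨aC, aE, BE, he⟩ := h
  set V := Submodule.span F (Set.range B.row)
  set E := LinearMap.range (rowForm (F := F) e)
  set Y := Submodule.span F (Set.range BE.row)
  -- Applying a linear form to `e = a_C B_C + a_E B_E` gives a combination of rows of `B` and `BE`.
  -- The bound is then the dimension formula for `V ⊔ E`, with `dim Y ≤ t`.
  have hE : E ≤ V ⊔ Y := by
    rintro _ ⟨φ, rfl⟩
    have : rowForm e φ = ∑ a, φ (aC a) • B.row a + ∑ a, φ (aE a) • BE.row a := by
      ext i
      have hc : ∀ (x : F) (y : K), φ (y * algebraMap F K x) = φ y * x := fun x y => by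
        rw [mul_comm, ← Algebra.smul_def, map_smul, smul_eq_mul, mul_comm]
      simp [rowForm_apply, he, Matrix.vecMul, dotProduct, map_sum, hc, Finset.sum_apply,
        Matrix.row]
    rw [this]
    exact Submodule.add_mem_sup
      (Submodule.sum_mem _ fun a _ => Submodule.smul_mem _ _ (Submodule.subset_span ⟨a, rfl⟩))
      (Submodule.sum_mem _ fun a _ => Submodule.smul_mem _ _ (Submodule.subset_span ⟨a, rfl⟩))
  have h1 := Submodule.finrank_sup_add_finrank_inf_eq V E
  have h2 : Module.finrank F (V ⊔ E : Submodule F (Fin n → F)) ≤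
      Module.finrank F (V ⊔ Y : Submodule F (Fin n → F)) :=
    Submodule.finrank_mono (sup_le le_sup_left hE)
  have h3 := Submodule.finrank_add_le_finrank_add_finrank V Y
  have h4 : Module.finrank F Y ≤ t :=
    (finrank_range_le_card (R := F) BE.row).trans_eq (Fintype.card_fin t)
  rw [finrank_range_rowForm] at h1
  omega

/-- The number of vectors of rank weight `j`. -/
theorem natCard_rankWeight_le [Fintype F] [Finite K] (j : ℕ) :
    (Nat.card {e : Fin n → K // rankWeight F e = j} : ℝ) ≤
      independentCount (Fintype.card F) (Module.finrank F K) j *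
        independentCount (Fintype.card F) n j / independentCount (Fintype.card F) j j := by
  have hq : 1 < Fintype.card F := Fintype.one_lt_card
  set q := Fintype.card F
  rw [le_div_iff₀ (independentCount_pos hq le_rfl)]
  let S := {e : Fin n → K // rankWeight F e = j}
  -- Rank factorization: a basis `x` of the span of the entries writes `e` as `∑ x_a y_a` with
  -- coordinate rows `y`. So pairs `(e, x)` inject into pairs `(x, y)`, and each `e` has
  -- `independentCount q j j` bases.
  have key : ∀ p : (Σ e : S, {x : Fin j → Submodule.span F (Set.range e.1) //
      LinearIndependent F x}), ∃ y : Fin j → Fin n → F, LinearIndependent F y ∧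
      ∀ i, p.1.1 i = ∑ a, y a i • (p.2.1 a : K) := by
    rintro ⟨e, x, hx⟩
    have : FiniteDimensional F (Submodule.span F (Set.range e.1)) := inferInstance
    let b := basisOfLinearIndependentOfCardEqFinrank' x hx
      (by rw [Fintype.card_fin]; exact e.2.symm)
    have hb : ∀ a, b a = x a := fun a => by simp [b]
    let e' : Fin n → Submodule.span F (Set.range e.1) :=
      fun i => ⟨e.1 i, Submodule.subset_span ⟨i, rfl⟩⟩
    refine ⟨fun a i => b.repr (e' i) a, ?_, fun i => ?_⟩
    · rw [Fintype.linearIndependent_iff]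
      intro c hc
      -- A relation among the coordinate rows is a linear form vanishing on all entries of `e`,
      -- hence on their span; evaluating it at the basis gives `c = 0`.
      let φ : Submodule.span F (Set.range e.1) →ₗ[F] F := ∑ a, c a • b.coord a
      have hspan : Submodule.span F (Set.range e') = ⊤ := by
        have := Submodule.span_span_coe_preimage (R := F) (s := Set.range e.1)
        rw [← this]
        congr 1
        ext v
        simp [e', Subtype.ext_iff]
      have hφ : φ = 0 := by
        refine LinearMap.ext_on_range hspan fun i => ?_
        simpa [φ] using congrFun hc i
      intro a
      simpa [φ, Finsupp.single_apply] using LinearMap.congr_fun hφ (b a)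
    · have := congrArg Subtype.val (b.sum_repr (e' i))
      rw [Submodule.coe_sum] at this
      simpa [hb, e'] using this.symm
  choose y hy hsum using key
  have hinj : Function.Injective (fun p : (Σ e : S,
      {x : Fin j → Submodule.span F (Set.range e.1) // LinearIndependent F x}) =>
      ((⟨fun a => p.2.1 a, p.2.2.map' _ (Submodule.ker_subtype _)⟩, ⟨y p, hy p⟩) :
        {x : Fin j → K // LinearIndependent F x} ×
          {y : Fin j → Fin n → F // LinearIndependent F y})) := by
    rintro ⟨e, x⟩ ⟨e', x'⟩ h
    have hx : ∀ a, (x.1 a : K) = x'.1 a := fun a =>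
      congrFun (congrArg (fun p => p.1.1) h) a
    have hy' : y ⟨e, x⟩ = y ⟨e', x'⟩ := congrArg (fun p => p.2.1) h
    obtain rfl : e = e' := by
      ext i
      rw [hsum ⟨e, x⟩ i, hsum ⟨e', x'⟩ i, hy']
      simp [hx]
    obtain rfl : x = x' := Subtype.ext (funext fun a => Subtype.ext (hx a))
    rfl
  have := Fintype.ofFinite S
  have hcard := Nat.card_le_card_of_injective _ hinj
  have hcard' : (Nat.card (Σ e : S,
      {x : Fin j → Submodule.span F (Set.range e.1) // LinearIndependent F x}) : ℝ) ≤
      (Nat.card ({x : Fin j → K // LinearIndependent F x} ×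
          {y : Fin j → Fin n → F // LinearIndependent F y}) : ℕ) := by exact_mod_cast hcard
  have hS : ∀ e : S, Module.finrank F (Submodule.span F (Set.range e.1)) = j := fun e => e.2
  rw [Nat.card_sigma, Nat.cast_sum, Nat.card_prod, Nat.cast_mul, natCard_linearIndependent,
    natCard_linearIndependent, Module.finrank_fin_fun,
    Finset.sum_congr rfl fun e _ => by rw [natCard_linearIndependent, hS],
    Finset.sum_const, Finset.card_univ, ← Nat.card_eq_fintype_card, nsmul_eq_mul] at hcard'
  exact hcard'

end RankWeight

/-! ### Repeated independent guesses -/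

/-- The probability that `i` independent guesses fail, averaged over uniform `x`, where `p x` is
the success probability of one guess. -/
noncomputable def avgFailure {X : Type*} [Fintype X] (p : X → ℝ) (i : ℕ) : ℝ :=
  (∑ x, (1 - p x) ^ i) / Fintype.card X

section Average

variable {X : Type*} [Fintype X] {p : X → ℝ}

theorem avgFailure_nonneg (hp : ∀ x, p x ≤ 1) (i : ℕ) : 0 ≤ avgFailure p i :=
  div_nonneg (Finset.sum_nonneg fun x _ => pow_nonneg (sub_nonneg.2 (hp x)) i) (Nat.cast_nonneg _)

/-- Chebyshev's sum inequality: a large success probability goes with few guesses. -/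
theorem one_sub_avgFailure_le [Nonempty X] (hp1 : ∀ x, p x ≤ 1) (N : ℕ) :
    1 - avgFailure p N ≤
      (∑ x, p x) / Fintype.card X * ∑ i ∈ Finset.range N, avgFailure p i := by
  have hc : (0 : ℝ) < Fintype.card X := by exact_mod_cast Fintype.card_pos
  have hgeom : ∀ x, p x * ∑ i ∈ Finset.range N, (1 - p x) ^ i = 1 - (1 - p x) ^ N := fun x => by
    have := mul_neg_geom_sum (1 - p x) N
    rwa [sub_sub_cancel] at this
  -- The hypothesis of Chebyshev's inequality: a smaller `p` makes each `(1 - p) ^ i` at least as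
  -- large.
  have hanti : Antivary p fun x => ∑ i ∈ Finset.range N, (1 - p x) ^ i := by
    intro x y hxy
    by_contra! h
    refine hxy.not_ge (Finset.sum_le_sum fun i _ => ?_)
    exact pow_le_pow_left₀ (sub_nonneg.2 (hp1 y)) (by linarith) i
  have h := hanti.card_mul_sum_le_sum_mul_sum
  simp only [hgeom] at h
  have hsum : ∑ x, (1 - (1 - p x) ^ N) = Fintype.card X * (1 - avgFailure p N) := by
    rw [Finset.sum_sub_distrib, avgFailure]
    simp
    field_simp
  have hsum' : ∑ x, ∑ i ∈ Finset.range N, (1 - p x) ^ i =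
      Fintype.card X * ∑ i ∈ Finset.range N, avgFailure p i := by
    rw [Finset.sum_comm, Finset.mul_sum]
    refine Finset.sum_congr rfl fun i _ => ?_
    rw [avgFailure]
    field_simp
  rw [hsum, hsum'] at h
  rw [div_mul_eq_mul_div, le_div_iff₀ hc]
  nlinarith

end Average

section Guesses

variable {Ω X G : Type*} [MeasurableSpace Ω] {P : Measure Ω} [IsProbabilityMeasure P]
  [MeasurableSpace X] [MeasurableSingletonClass X] [Fintype X]
  [MeasurableSpace G] [DiscreteMeasurableSpace G] [Fintype G]
  {r : Ω → X} {U : ℕ → Ω → G} {S : X → Set G}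

/-- The event that the first `i` guesses fail. -/
def failureEvent (r : Ω → X) (U : ℕ → Ω → G) (S : X → Set G) (i : ℕ) : Set Ω :=
  {ω | ∀ l < i, U l ω ∉ S (r ω)}

omit [IsProbabilityMeasure P] in
theorem measure_preimage_of_uniform {Y : Type*} [MeasurableSpace Y] [MeasurableSingletonClass Y]
    [Fintype Y] [Nonempty Y] {f : Ω → Y} (hf : Measurable f)
    (hu : P.map f = uniformOn Set.univ) (A : Set Y) :
    P (f ⁻¹' A) = ENNReal.ofReal (Nat.card A / Fintype.card Y) := by
  have hA : MeasurableSet A := A.toFinite.measurableSet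
  have hc : (0 : ℝ) < Fintype.card Y := by exact_mod_cast Fintype.card_pos
  rw [← Measure.map_apply hf hA, hu, uniformOn_univ, Measure.count_apply hA,
    ENNReal.ofReal_div_of_pos hc, ENNReal.ofReal_natCast, ENNReal.ofReal_natCast,
    ← A.toFinite.cast_ncard_eq, Nat.card_coe_set_eq, ENat.toENNReal_coe]

omit [Fintype G] in
theorem measurableSet_failureEvent (hr : Measurable r) (hU : ∀ i, Measurable (U i)) (i : ℕ) :
    MeasurableSet (failureEvent r U S i) := by
  have : failureEvent r U S i = ⋃ x, (r ⁻¹' {x} ∩ ⋂ l ∈ Finset.range i, U l ⁻¹' (S x)ᶜ) := by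
    ext ω
    simp [failureEvent]
  rw [this]
  exact MeasurableSet.iUnion fun x => (hr (measurableSet_singleton x)).inter
    (Finset.measurableSet_biInter _ fun l _ => hU l (MeasurableSet.of_discrete))

-- Splitting by the value `x` of `r`, independence gives `(1 - p x) ^ i / |X|` for each `x`.
omit [IsProbabilityMeasure P] in
theorem measure_failureEvent (hr : Measurable r) (hU : ∀ i, Measurable (U i))
    (hr_unif : P.map r = uniformOn Set.univ) (hU_unif : ∀ i, P.map (U i) = uniformOn Set.univ)
    (hU_indep : iIndepFun U P) (hrU_indep : IndepFun r (fun ω i => U i ω) P)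
    [Nonempty X] [Nonempty G] (i : ℕ) :
    P (failureEvent r U S i) =
      ENNReal.ofReal (avgFailure (fun x => (Nat.card (S x) : ℝ) / Fintype.card G) i) := by
  have hG : (0 : ℝ) < Fintype.card G := by exact_mod_cast Fintype.card_pos
  have hp1 : ∀ x, (Nat.card (S x) : ℝ) / Fintype.card G ≤ 1 := fun x => by
    rw [div_le_one hG, ← Nat.card_eq_fintype_card]
    exact_mod_cast Finite.card_subtype_le _
  have hset : failureEvent r U S i =
      ⋃ x ∈ (Finset.univ : Finset X),
        (r ⁻¹' {x} ∩ (fun ω i => U i ω) ⁻¹' {u | ∀ l ∈ Finset.range i, u l ∈ (S x)ᶜ}) := by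
    ext ω
    simp [failureEvent]
  have hmeas : ∀ x, MeasurableSet {u : ℕ → G | ∀ l ∈ Finset.range i, u l ∈ (S x)ᶜ} := fun x => by
    have : {u : ℕ → G | ∀ l ∈ Finset.range i, u l ∈ (S x)ᶜ} =
        ⋂ l ∈ Finset.range i, (fun u : ℕ → G => u l) ⁻¹' (S x)ᶜ := by ext; simp
    rw [this]
    exact Finset.measurableSet_biInter _ fun l _ =>
      measurable_pi_apply l (MeasurableSet.of_discrete)
  rw [hset, measure_biUnion_finset]
  · have hterm : ∀ x, P (r ⁻¹' {x} ∩
        (fun ω i => U i ω) ⁻¹' {u | ∀ l ∈ Finset.range i, u l ∈ (S x)ᶜ}) =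
        ENNReal.ofReal ((1 - (Nat.card (S x) : ℝ) / Fintype.card G) ^ i / Fintype.card X) := by
      intro x
      have hpre : (fun ω i => U i ω) ⁻¹' {u | ∀ l ∈ Finset.range i, u l ∈ (S x)ᶜ} =
          ⋂ l ∈ Finset.range i, U l ⁻¹' (S x)ᶜ := by ext; simp
      have hone : ∀ l, P (U l ⁻¹' (S x)ᶜ) =
          ENNReal.ofReal (1 - (Nat.card (S x) : ℝ) / Fintype.card G) := fun l => by
        rw [measure_preimage_of_uniform (hU l) (hU_unif l)]
        congr 1
        have := Set.ncard_add_ncard_compl (S x)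
        rw [Nat.card_eq_fintype_card, ← Nat.card_coe_set_eq, ← Nat.card_coe_set_eq] at this
        rw [← this] at hG ⊢
        push_cast at hG ⊢
        field_simp
        ring
      rw [hrU_indep.measure_inter_preimage_eq_mul _ _ (measurableSet_singleton x) (hmeas x), hpre,
        hU_indep.measure_inter_preimage_eq_mul _ fun _ _ => MeasurableSet.of_discrete,
        Finset.prod_congr rfl fun l _ => hone l, Finset.prod_const, Finset.card_range,
        measure_preimage_of_uniform hr hr_unif, ← ENNReal.ofReal_pow (sub_nonneg.2 (hp1 x)),
        ← ENNReal.ofReal_mul (by positivity)]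
      congr 1
      simp
      ring
    rw [Finset.sum_congr rfl fun x _ => hterm x, ← ENNReal.ofReal_sum_of_nonneg, avgFailure,
      Finset.sum_div]
    intro x _
    exact div_nonneg (pow_nonneg (sub_nonneg.2 (hp1 x)) i) (Nat.cast_nonneg _)
  · intro x _ y _ hxy
    refine Set.disjoint_left.2 fun ω h1 h2 => hxy ?_
    exact h1.1.symm.trans h2.1
  · intro x _
    exact (hr (measurableSet_singleton x)).inter ((measurable_pi_lambda _ hU) (hmeas x))

/-- The probability that one of the first `N` guesses succeeds is bounded by the expected number
of guesses. -/
theorem ofReal_mul_measure_compl_failureEvent_le (hr : Measurable r) (hU : ∀ i, Measurable (U i))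
    (hr_unif : P.map r = uniformOn Set.univ) (hU_unif : ∀ i, P.map (U i) = uniformOn Set.univ)
    (hU_indep : iIndepFun U P) (hrU_indep : IndepFun r (fun ω i => U i ω) P)
    [Nonempty X] [Nonempty G] {a c : ℝ} (ha : 0 ≤ a)
    (hac : a * ((∑ x, (Nat.card (S x) : ℝ) / Fintype.card G) / Fintype.card X) ≤ c) (N : ℕ) :
    ENNReal.ofReal a * P (failureEvent r U S N)ᶜ ≤
      ∑ i ∈ Finset.range N, ENNReal.ofReal c * P (failureEvent r U S i) := by
  have hP := measure_failureEvent (S := S) hr hU hr_unif hU_unif hU_indep hrU_indep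
  have hp1 : ∀ x, (Nat.card (S x) : ℝ) / Fintype.card G ≤ 1 := fun x => by
    rw [div_le_one (by exact_mod_cast Fintype.card_pos), ← Nat.card_eq_fintype_card]
    exact_mod_cast Finite.card_subtype_le _
  have hf := fun i => avgFailure_nonneg hp1 i
  have hc : 0 ≤ c := le_trans (by positivity) hac
  rw [prob_compl_eq_one_sub (measurableSet_failureEvent hr hU N), hP, ← ENNReal.ofReal_one,
    ← ENNReal.ofReal_sub _ (hf N), ← ENNReal.ofReal_mul ha]
  simp only [hP, ← ENNReal.ofReal_mul hc]
  rw [← ENNReal.ofReal_sum_of_nonneg fun i _ => mul_nonneg hc (hf i), ← Finset.mul_sum]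
  refine ENNReal.ofReal_le_ofReal ?_
  calc _ ≤ _ := mul_le_mul_of_nonneg_left (one_sub_avgFailure_le hp1 N) ha
    _ = _ := (mul_assoc ..).symm
    _ ≤ _ := mul_le_mul_of_nonneg_right hac (Finset.sum_nonneg fun i _ => hf i)

omit [MeasurableSpace X] [MeasurableSingletonClass X] [Fintype X] [MeasurableSpace G]
  [DiscreteMeasurableSpace G] [Fintype G] in
/-- Without a limit on the number of guesses, either the expected number of guesses is infinite
or some guess succeeds almost surely. -/
theorem ofReal_le_of_forall_sum_le {a c : ℝ} (hc : 0 < c) {I : ℝ≥0∞}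
    (h : ∀ N, ENNReal.ofReal a * P (failureEvent r U S N)ᶜ ≤
      ∑ i ∈ Finset.range N, ENNReal.ofReal c * P (failureEvent r U S i))
    (hI : ∀ N, ∑ i ∈ Finset.range N, ENNReal.ofReal c * P (failureEvent r U S i) ≤ I) :
    ENNReal.ofReal a ≤ I := by
  rcases eq_or_ne I ⊤ with rfl | hI'
  · exact le_top
  have hsum : ∑' i, P (failureEvent r U S i) ≠ ⊤ := by
    have h1 : ∑' i, ENNReal.ofReal c * P (failureEvent r U S i) ≤ I :=
      ENNReal.tsum_le_of_sum_range_le hI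
    rw [ENNReal.tsum_mul_left] at h1
    intro h2
    rw [h2, ENNReal.mul_top (by simpa using hc)] at h1
    exact hI' (top_le_iff.1 h1)
  have h0 : Filter.Tendsto (fun N => P (failureEvent r U S N)) Filter.atTop (nhds 0) :=
    ENNReal.tendsto_atTop_zero_of_tsum_ne_top hsum
  -- Subadditivity alone gives `1 - P(A) ≤ P(Aᶜ)`, so no measurability is required.
  have hbound : ∀ N, ENNReal.ofReal a * (1 - P (failureEvent r U S N)) ≤ I := fun N =>
    (mul_le_mul_right (tsub_le_iff_left.2 (by
      rw [← measure_univ (μ := P), ← Set.union_compl_self (failureEvent r U S N)]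
      exact measure_union_le _ _)) _).trans ((h N).trans (hI N))
  have hlim : Filter.Tendsto (fun N => ENNReal.ofReal a * (1 - P (failureEvent r U S N)))
      Filter.atTop (nhds (ENNReal.ofReal a * (1 - 0))) :=
    ENNReal.Tendsto.const_mul (ENNReal.Tendsto.sub tendsto_const_nhds h0 (by simp)) (by simp)
  simpa using le_of_tendsto' hlim hbound

omit [Fintype G] [IsProbabilityMeasure P] in
/-- If every guess costs at least `c`, then the expected cost is at least `c` times the expected
number of guesses. -/
theorem sum_measure_failureEvent_le_lintegral (hr : Measurable r) (hU : ∀ i, Measurable (U i))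
    {c N : ℕ} {f : Ω → ℝ≥0∞} [∀ ω i, Decidable (∀ l < i, U l ω ∉ S (r ω))]
    (hf : ∀ ω, ((∑ i ∈ Finset.range N, if ∀ l < i, U l ω ∉ S (r ω) then c else 0 : ℕ) : ℝ≥0∞) ≤
      f ω) :
    ∑ i ∈ Finset.range N, (c : ℝ≥0∞) * P (failureEvent r U S i) ≤ ∫⁻ ω, f ω ∂P := by
  have hm := fun i => measurableSet_failureEvent (S := S) hr hU i
  calc _ = ∑ i ∈ Finset.range N,
        ∫⁻ ω, (failureEvent r U S i).indicator (fun _ => (c : ℝ≥0∞)) ω ∂P :=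
      Finset.sum_congr rfl fun i _ => by rw [lintegral_indicator_const (hm i)]
    _ = ∫⁻ ω, ∑ i ∈ Finset.range N,
        (failureEvent r U S i).indicator (fun _ => (c : ℝ≥0∞)) ω ∂P :=
      (lintegral_finsetSum _ fun i _ => measurable_const.indicator (hm i)).symm
    _ ≤ _ := lintegral_mono fun ω => le_trans (le_of_eq ?_) (hf ω)
  rw [Nat.cast_sum]
  refine Finset.sum_congr rfl fun i _ => ?_
  by_cases h : ∀ l < i, U l ω ∉ S (r ω)
  · rw [if_pos h, Set.indicator_of_mem (by exact h)]
  · rw [if_neg h, Set.indicator_of_notMem (by exact h), Nat.cast_zero]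

end Guesses

/-! ### The randomized decoder -/

section Decoder

variable {F K : Type*} [Field F] [Field K] [Algebra F K] {n δ : ℕ}

/-- The guesses for which an iteration on the received word `r` outputs a codeword. -/
def successSet (q w : ℕ) (T : ArithTree K (DecReg n δ) n)
    (B : Grass F n δ → Matrix (Fin δ) (Fin n) F) (r : Fin n → K) : Set (Grass F n δ) :=
  {V | ∃ c, (decode q T r (B V)).1 = some c ∧ rankWeight F (r - c) ≤ w}

variable {q w : ℕ} {T : ArithTree K (DecReg n δ) n} {B : Grass F n δ → Matrix (Fin δ) (Fin n) F}
  {r : Fin n → K}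

theorem exists_mem_successSet_of_randomizedDecoder {N : ℕ} {U : ℕ → Grass F n δ} {c : Fin n → K}
    (h : (randomizedDecoder q w T B r N U).1 = some c) :
    ∃ l < N, U l ∈ successSet q w T B r := by
  induction N generalizing U with
  | zero => simp [randomizedDecoder] at h
  | succ N ih =>
    by_cases h0 : U 0 ∈ successSet q w T B r
    · exact ⟨0, N.succ_pos, h0⟩
    · have hrest : (randomizedDecoder q w T B r N fun i => U (i + 1)).1 = some c := by
        rw [randomizedDecoder] at h
        cases hd : (decode q T r (B (U 0))).1 with
        | none => simpa [hd] using h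
        | some c' =>
          have hc' : ¬ rankWeight F (r - c') ≤ w := fun hc' => h0 ⟨c', hd, hc'⟩
          simpa [hd, hc'] using h
      obtain ⟨l, hl, hlU⟩ := ih hrest
      exact ⟨l + 1, Nat.succ_lt_succ hl, hlU⟩

-- Iteration `i`, counted from `0`, is carried out exactly when all guesses `l < i` fail, and then
-- costs at least `b`; the subtractions are dropped.
open Classical in
theorem sum_le_randomizedDecoder_ops {b : ℕ} (hb : ∀ V, b ≤ (decode q T r (B V)).2) (N : ℕ)
    (U : ℕ → Grass F n δ) :
    (∑ i ∈ Finset.range N, if ∀ l < i, U l ∉ successSet q w T B r then b else 0) ≤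
      (randomizedDecoder q w T B r N U).2 := by
  induction N generalizing U with
  | zero => simp
  | succ N ih =>
    rw [Finset.sum_range_succ']
    have hb0 := hb (U 0)
    simp only [not_lt_zero, false_imp_iff, implies_true, if_true]
    by_cases h0 : U 0 ∈ successSet q w T B r
    · have hz : ∀ i, ¬ ∀ l < i + 1, U l ∉ successSet q w T B r :=
        fun i h => h 0 i.succ_pos h0
      simp only [hz, if_false, Finset.sum_const_zero, zero_add]
      obtain ⟨c, hc, hcw⟩ := h0
      rw [randomizedDecoder]
      simp only [hc, hcw, if_true]
      omega
    · have hs : ∀ i, (∀ l < i + 1, U l ∉ successSet q w T B r) ↔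
          ∀ l < i, U (l + 1) ∉ successSet q w T B r := fun i =>
        ⟨fun h l hl => h (l + 1) (Nat.succ_lt_succ hl), fun h l hl => by
          cases l with
          | zero => exact h0
          | succ l => exact h l (Nat.lt_of_succ_lt_succ hl)⟩
      simp only [hs]
      have hrest := ih fun i => U (i + 1)
      rw [randomizedDecoder]
      cases hd : (decode q T r (B (U 0))).1 with
      | none => simp only; omega
      | some c =>
        have hc : ¬ rankWeight F (r - c) ≤ w := fun hc => h0 ⟨c, hd, hc⟩
        simp only [hc, if_false]
        omega

/-- The `k` generator rows span the code, so its dimension is at most `k`. -/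
theorem natCard_gabidulinCode_le [Finite K] (q k : ℕ) (g : Fin n → K) :
    Nat.card (gabidulinCode q k g) ≤ Nat.card K ^ k := by
  rw [Module.natCard_eq_pow_finrank (K := K)]
  refine Nat.pow_le_pow_right Nat.card_pos ?_
  exact (finrank_range_le_card (R := K) (gabidulinMatrix q k g).row).trans_eq (Fintype.card_fin k)

/-- The probability that a random guess helps to decode an error of rank weight `j` is at most
`P_{n,k,δ,j}`. -/
theorem natCard_erasureDecomp_le [Fintype F] [FiniteDimensional F K] {k : ℕ} (hkn : k ≤ n)
    (hδ : δ ≤ n - k)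
    (hB : ∀ V : Grass F n δ, Submodule.span F (Set.range (B V).row) = V.1) (e : Fin n → K) :
    (Nat.card {V : Grass F n δ // ∃ t, 2 * t + δ ≤ n - k ∧ HasErasureDecomp e (B V) t} : ℝ) ≤
      Nat.card (Grass F n δ) * guessProb (Fintype.card F) n k δ (rankWeight F e) := by
  have hq : 1 < Fintype.card F := Fintype.one_lt_card
  rw [guessProb]
  split_ifs with hj
  · have hpos := gaussBinom_pos hq (show δ ≤ n by omega)
    have hG := gaussBinom_le_natCard_grass (F := F) (n := n) (δ := δ)
    have hS : (Nat.card {V : Grass F n δ //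
        ∃ t, 2 * t + δ ≤ n - k ∧ HasErasureDecomp e (B V) t} : ℝ) ≤
        guessSum (Fintype.card F) n k δ (rankWeight F e) := by
      -- Eliminating `t` from `j ≤ dim (V ⊓ E) + t` and `2t + δ ≤ n - k` gives the lower summation
      -- index of `guessSum`.
      have himp : ∀ V : Grass F n δ,
          (∃ t, 2 * t + δ ≤ n - k ∧ HasErasureDecomp e (B V) t) →
          ⌈(rankWeight F e : ℝ) - ((n : ℝ) - (k : ℝ)) / 2 + (δ : ℝ) / 2⌉₊ ≤ Module.finrank F
            (V.1 ⊓ LinearMap.range (rowForm (F := F) e) : Submodule F (Fin n → F)) := by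
        rintro V ⟨t, ht, hV⟩
        have h := hV.rankWeight_le
        rw [hB] at h
        rw [Nat.ceil_le]
        have h' : (rankWeight F e : ℝ) ≤ Module.finrank F
          (V.1 ⊓ LinearMap.range (rowForm (F := F) e) : Submodule F (Fin n → F)) + t := by
          exact_mod_cast h
        have ht' : 2 * (t : ℝ) + δ + k ≤ n := by
          have : 2 * t + δ + k ≤ n := by omega
          exact_mod_cast this
        linarith
      have hle := Nat.card_mono (Set.toFinite {V : Grass F n δ |
        ⌈(rankWeight F e : ℝ) - ((n : ℝ) - (k : ℝ)) / 2 + (δ : ℝ) / 2⌉₊ ≤ Module.finrank F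
            (V.1 ⊓ LinearMap.range (rowForm (F := F) e) : Submodule F (Fin n → F))}) himp
      refine le_trans (Nat.cast_le.2 hle) ((natCard_grass_le_inter_le _ _).trans_eq ?_)
      rw [finrank_range_rowForm]
      rfl
    have hS0 : 0 ≤ guessSum (Fintype.card F) n k δ (rankWeight F e) :=
      le_trans (Nat.cast_nonneg _) hS
    rw [mul_div_assoc', le_div_iff₀ hpos]
    calc _ ≤ _ := mul_le_mul hS hG hpos.le hS0
      _ = _ := mul_comm _ _
  · rw [mul_one]
    exact_mod_cast Finite.card_subtype_le _

theorem guessProb_nonneg {q : ℕ} (hq : 1 < q) (n k δ j : ℕ) : 0 ≤ guessProb q n k δ j := by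
  rw [guessProb]
  split_ifs
  · refine div_nonneg (Finset.sum_nonneg fun i _ => ?_) (gaussBinom_nonneg hq _ _)
    exact mul_nonneg (mul_nonneg (gaussBinom_nonneg hq _ _) (gaussBinom_nonneg hq _ _))
      (by positivity)
  · exact zero_le_one

theorem avgCount_eq (q m n k j : ℕ) :
    avgCount q m n k j = (q : ℝ) ^ ((m : ℤ) * ((k : ℤ) - (n : ℤ))) *
      (independentCount q m j * independentCount q n j / independentCount q j j) := by
  rw [avgCount, Finset.prod_div_distrib, Finset.prod_mul_distrib]
  rfl

/-- The average success probability of an iteration. -/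
theorem average_successSet_le [Fintype F] [Fintype K] {k : ℕ} (hkn : k ≤ n) (hδ : δ ≤ n - k)
    {g : Fin n → K} (hq : Fintype.card F = q) (hT : IsErrorErasureDecoder F q k g T)
    (hB : ∀ V : Grass F n δ, Submodule.span F (Set.range (B V).row) = V.1)
    [Fintype (Grass F n δ)] :
    (∑ x : Fin n → K, (Nat.card (successSet q w T B x) : ℝ) / Fintype.card (Grass F n δ)) /
        Fintype.card (Fin n → K) ≤
      ∑ j ∈ Finset.range (w + 1),
        avgCount q (Module.finrank F K) n k j * guessProb q n k δ j := by
  classical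
  have hq1 : 1 < q := hq ▸ Fintype.one_lt_card
  set m := Module.finrank F K
  have hcardK : Fintype.card K = q ^ m := by rw [Module.card_eq_pow_finrank (K := F), hq]
  have hli : ∀ V : Grass F n δ, LinearIndependent F (B V).row := fun V => by
    rw [linearIndependent_iff_card_eq_finrank_span, Set.finrank, hB V, V.2, Fintype.card_fin]
  let D : (Fin n → K) → Type _ := fun e =>
    {V : Grass F n δ // ∃ t, 2 * t + δ ≤ n - k ∧ HasErasureDecomp e (B V) t}
  let E := {e : Fin n → K // rankWeight F e ≤ w}
  have hspec : ∀ p : (Σ x : Fin n → K, successSet q w T B x), ∃ c ∈ gabidulinCode q k g,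
      rankWeight F (p.1 - c) ≤ w ∧
        ∃ t, 2 * t + δ ≤ n - k ∧ HasErasureDecomp (p.1 - c) (B p.2.1) t := by
    rintro ⟨x, V, c, hc, hcw⟩
    obtain ⟨h1, h2⟩ := (hT x (B V) (hli V) c).1 hc
    exact ⟨c, h1, hcw, h2⟩
  choose c hc hcw hdec using hspec
  -- The double count: `x` is recovered as codeword plus error.
  have hinj : Function.Injective (fun p : (Σ x : Fin n → K, successSet q w T B x) =>
      ((⟨c p, hc p⟩, ⟨⟨p.1 - c p, hcw p⟩, ⟨p.2.1, hdec p⟩⟩) :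
        gabidulinCode q k g × (Σ e : E, D e.1))) := by
    intro p p' h
    have h1 : c p = c p' := congrArg (fun y => (y.1 : Fin n → K)) h
    have h2 : p.1 - c p = p'.1 - c p' := congrArg (fun y => (y.2.1.1 : Fin n → K)) h
    have h3 : p.2.1 = p'.2.1 := congrArg (fun y => (y.2.2.1 : Grass F n δ)) h
    obtain ⟨x, V⟩ := p
    obtain ⟨x', V'⟩ := p'
    obtain rfl : x = x' := by
      rw [h1] at h2
      exact sub_left_injective h2
    obtain rfl : V = V' := Subtype.ext h3
    rfl
  have hG : (0 : ℝ) ≤ Fintype.card (Grass F n δ) := Nat.cast_nonneg _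
  have hcode : (Nat.card (gabidulinCode q k g) : ℝ) ≤ (q : ℝ) ^ (m * k) := by
    have := natCard_gabidulinCode_le q k g
    rw [Nat.card_eq_fintype_card (α := K), hcardK, ← pow_mul] at this
    exact_mod_cast this
  have hD : (∑ e : E, (Nat.card (D e.1) : ℝ)) ≤ Fintype.card (Grass F n δ) *
      ∑ j ∈ Finset.range (w + 1), (independentCount q m j * independentCount q n j /
        independentCount q j j) * guessProb q n k δ j := by
    calc _ ≤ ∑ e : E, (Fintype.card (Grass F n δ) : ℝ) *
          guessProb q n k δ (rankWeight F e.1) := by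
          refine Finset.sum_le_sum fun e _ => ?_
          have := natCard_erasureDecomp_le (K := K) hkn hδ hB e.1
          rwa [hq, Nat.card_eq_fintype_card (α := Grass F n δ)] at this
      _ = Fintype.card (Grass F n δ) * ∑ e : E, guessProb q n k δ (rankWeight F e.1) := by
          rw [Finset.mul_sum]
      _ = Fintype.card (Grass F n δ) * ∑ j ∈ Finset.range (w + 1),
          ∑ e : E with rankWeight F e.1 = j, guessProb q n k δ (rankWeight F e.1) := by
          rw [Finset.sum_fiberwise_of_maps_to]
          exact fun e _ => Finset.mem_range.2 (Nat.lt_succ_of_le e.2)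
      _ ≤ _ := by
          refine mul_le_mul_of_nonneg_left (Finset.sum_le_sum fun j _ => ?_) hG
          rw [Finset.sum_congr rfl fun e he => by rw [(Finset.mem_filter.1 he).2],
            Finset.sum_const, nsmul_eq_mul]
          refine mul_le_mul_of_nonneg_right ?_ (guessProb_nonneg hq1 _ _ _ _)
          have h1 := natCard_rankWeight_le (F := F) (K := K) (n := n) j
          rw [hq] at h1
          refine le_trans (Nat.cast_le.2 ?_) h1
          rw [Nat.card_eq_fintype_card, Fintype.card_subtype]
          exact Finset.card_le_card_of_injOn (fun e : E => e.1)
            (fun e he => by simpa using he) Subtype.val_injective.injOn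
  have hcard : (∑ x : Fin n → K, (Nat.card (successSet q w T B x) : ℝ)) ≤
      (Nat.card (gabidulinCode q k g) : ℝ) * ∑ e : E, (Nat.card (D e.1) : ℝ) := by
    have := Nat.card_le_card_of_injective _ hinj
    rw [Nat.card_prod, Nat.card_sigma, Nat.card_sigma] at this
    exact_mod_cast this
  set z := (q : ℝ) ^ ((m : ℤ) * ((k : ℤ) - (n : ℤ))) with hz
  have hzq : z * (q : ℝ) ^ (m * n) = (q : ℝ) ^ (m * k) := by
    have h0 : (q : ℝ) ≠ 0 := by positivity
    rw [hz, ← zpow_natCast, ← zpow_natCast, ← zpow_add₀ h0]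
    congr 1
    push_cast
    ring
  have hX : (Fintype.card (Fin n → K) : ℝ) = (q : ℝ) ^ (m * n) := by
    rw [Fintype.card_fun, hcardK, Fintype.card_fin, ← pow_mul]
    push_cast
    rfl
  simp only [avgCount_eq, mul_assoc, ← hz]
  rw [← Finset.mul_sum]
  set total := ∑ j ∈ Finset.range (w + 1), independentCount q m j * independentCount q n j /
    independentCount q j j * guessProb q n k δ j
  have htotal : 0 ≤ total := Finset.sum_nonneg fun j _ => mul_nonneg
    (div_nonneg (mul_nonneg (independentCount_nonneg hq1 _ _) (independentCount_nonneg hq1 _ _))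
      (independentCount_nonneg hq1 _ _)) (guessProb_nonneg hq1 _ _ _ _)
  rw [← Finset.sum_div, hX]
  refine div_le_of_le_mul₀ (by positivity) (by positivity) (div_le_of_le_mul₀ hG (by positivity) ?_)
  calc _ ≤ _ := hcard
    _ ≤ (q : ℝ) ^ (m * k) * (Fintype.card (Grass F n δ) * total) :=
      mul_le_mul hcode hD (Finset.sum_nonneg fun _ _ => Nat.cast_nonneg _) (by positivity)
    _ = _ := by rw [← hzq]; ring

end Decoder

/-! ### The work factor -/

/-- The given `δ` is one of the competitors in the minimum. The `max` with `0` supplies a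
nonnegative factor without examining the sign of the infimum; `b = 0` is covered because `b / b ≤ 1`
still holds. -/
theorem workFactor_mul_le {q m n k w δ : ℕ} (hδ : 2 * w - (n - k) ≤ δ) (hδ' : δ ≤ n - k) {a : ℝ}
    (ha : 0 ≤ a)
    (h : a ≤ ∑ j ∈ Finset.range (w + 1), avgCount q m n k j * guessProb q n k δ j) :
    max (workFactor q m n k w) 0 * a ≤ (n : ℝ) ^ 2 := by
  set b := ∑ j ∈ Finset.range (w + 1), avgCount q m n k j * guessProb q n k δ j with hb
  have hle : workFactor q m n k w ≤ (n : ℝ) ^ 2 / b :=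
    csInf_le ((Set.finite_Icc _ _).image _).bddBelow ⟨δ, ⟨hδ, hδ'⟩, rfl⟩
  have hb0 : 0 ≤ b := ha.trans h
  calc _ ≤ (n : ℝ) ^ 2 / b * b :=
        mul_le_mul (max_le hle (by positivity)) h ha (by positivity)
    _ = (n : ℝ) ^ 2 * (b / b) := by ring
    _ ≤ _ := mul_le_of_le_one_right (by positivity) (div_self_le_one b)

theorem workFactor_eq_workFactorExplicit {q m n k w : ℕ} (hq : 1 < q) (hw : n - k < 2 * w) :
    workFactor q m n k w = workFactorExplicit q m n k w := by
  rw [workFactor, workFactorExplicit]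
  congr 1
  refine Set.image_congr fun δ hδ => ?_
  have hG : gaussBinom q n δ ≠ 0 := (gaussBinom_pos hq (hδ.2.trans (Nat.sub_le n k))).ne'
  have h1 := hδ.1
  have h2 := hδ.2
  rw [mul_comm ((n : ℝ) ^ 2), ← mul_div_mul_left _ _ hG]
  congr 1
  -- `2 j + δ > n - k` holds exactly for `j` above `⌊(n-k-δ)/2⌋`, which is at most `w` since `n - k
  -- < 2 w`.
  have hsplit : Finset.range (w + 1) =
      Finset.Icc 0 ((n - k - δ) / 2) ∪ Finset.Icc ((n - k - δ) / 2 + 1) w := by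
    ext j
    simp only [Finset.mem_range, Finset.mem_union, Finset.mem_Icc]
    omega
  have hdisj : Disjoint (Finset.Icc 0 ((n - k - δ) / 2))
      (Finset.Icc ((n - k - δ) / 2 + 1) w) := by
    refine Finset.disjoint_left.2 fun j hj hj' => ?_
    simp only [Finset.mem_Icc] at hj hj'
    omega
  rw [hsplit, Finset.sum_union hdisj, mul_add, Finset.mul_sum, Finset.mul_sum, Finset.mul_sum]
  congr 1 <;> refine Finset.sum_congr rfl fun j hj => ?_ <;> rw [Finset.mem_Icc] at hj <;>
    rw [guessProb]
  · rw [if_neg (by omega), mul_one]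
  · rw [if_pos (by omega)]
    field_simp

/-! ### The main theorem -/

theorem theorem1
    {F K : Type*} [Field F] [Fintype F] [Field K] [Algebra F K]
    [MeasurableSpace K] [MeasurableSingletonClass K]
    (q m n k w δ : ℕ)
    (hq : Fintype.card F = q) (hm : Module.finrank F K = m)
    (hnm : n ≤ m) (hkn : k ≤ n)
    -- the error weight is beyond the unique decoding radius, and the range of `δ` is nonempty
    (hw : n - k < 2 * w) (hw' : w ≤ n - k)
    (hδ : 2 * w - (n - k) ≤ δ) (hδ' : δ ≤ n - k)
    (g : Fin n → K) (hg : LinearIndependent F g)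
    -- an error-erasure decoder; each of its runs takes at least `n ^ 2` operations over `K`
    (T : ArithTree K (DecReg n δ) n) (hT : IsErrorErasureDecoder F q k g T)
    (hcost : ∀ (x : Fin n → K) (M : Matrix (Fin δ) (Fin n) F),
      LinearIndependent F M.row → n ^ 2 ≤ (decode q T x M).2)
    -- the choice of a matrix with a given row space
    (B : Grass F n δ → Matrix (Fin δ) (Fin n) F)
    (hB : ∀ V : Grass F n δ, Submodule.span F (Set.range (B V).row) = V.1)
    -- a uniform received word, and independent uniform guesses
    {Ω : Type*} [MeasurableSpace Ω] (P : Measure Ω) [IsProbabilityMeasure P]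
    (r : Ω → Fin n → K) (U : ℕ → Ω → Grass F n δ)
    (hr : Measurable r) (hU : ∀ i, Measurable (U i))
    (hr_unif : P.map r = uniformOn Set.univ)
    (hU_unif : ∀ i, P.map (U i) = uniformOn Set.univ)
    (hU_indep : iIndepFun U P)
    (hrU_indep : IndepFun r (fun ω i => U i ω) P) :
    -- run until a codeword is output: the average number of operations is at least `W_RD`
    ENNReal.ofReal (workFactor q m n k w)
        ≤ ∫⁻ ω, unlimitedOps q w T B (r ω) (fun i => U i ω) ∂P ∧
    -- at most `N` iterations: at least `W_RD` operations on average per codeword output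
    (∀ N : ℕ,
      ENNReal.ofReal (workFactor q m n k w) *
          P {ω | ∃ c ∈ gabidulinCode q k g, rankWeight F (r ω - c) ≤ w ∧
            (randomizedDecoder q w T B (r ω) N (fun i => U i ω)).1 = some c}
        ≤ ∫⁻ ω, ((randomizedDecoder q w T B (r ω) N (fun i => U i ω)).2 : ℝ≥0∞) ∂P) ∧
    -- the explicit form of `W_RD`
    workFactor q m n k w = workFactorExplicit q m n k w := by
  classical
  have hq1 : 1 < q := hq ▸ Fintype.one_lt_card
  have hn : 0 < n := by omega
  -- An infinite extension has `finrank` zero, which `0 < n ≤ m` excludes; so `K` is finite.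
  have : FiniteDimensional F K := Module.finite_of_finrank_pos (by omega)
  have : Finite K := Module.finite_of_finite F
  have := Fintype.ofFinite K
  have := Fintype.ofFinite (Grass F n δ)
  have : Nonempty (Grass F n δ) := by
    have := (gaussBinom_pos (Fintype.one_lt_card (α := F)) (show δ ≤ n by omega)).trans_le
      (gaussBinom_le_natCard_grass (F := F))
    exact (Nat.card_pos_iff.1 (by exact_mod_cast this)).1
  have : DiscreteMeasurableSpace (Grass F n δ) := ⟨fun _ => trivial⟩
  have hb : ∀ (x : Fin n → K) (V : Grass F n δ), n ^ 2 ≤ (decode q T x (B V)).2 := fun x V =>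
    hcost x (B V) (by
      rw [linearIndependent_iff_card_eq_finrank_span, Set.finrank, hB V, V.2, Fintype.card_fin])
  let S : (Fin n → K) → Set (Grass F n δ) := successSet q w T B
  have havg := average_successSet_le (w := w) hkn hδ' hq hT hB
  rw [hm] at havg
  have hguess := ofReal_mul_measure_compl_failureEvent_le (S := S) hr hU hr_unif hU_unif hU_indep
    hrU_indep (le_max_right (workFactor q m n k w) 0)
    (workFactor_mul_le hδ hδ' (by positivity) havg)
  have hops : ∀ N, ∑ i ∈ Finset.range N, ENNReal.ofReal ((n : ℝ) ^ 2) * P (failureEvent r U S i) ≤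
      ∫⁻ ω, ((randomizedDecoder q w T B (r ω) N (fun i => U i ω)).2 : ℝ≥0∞) ∂P := fun N => by
    rw [show ENNReal.ofReal ((n : ℝ) ^ 2) = ((n ^ 2 : ℕ) : ℝ≥0∞) by
      rw [← ENNReal.ofReal_natCast]; push_cast; rfl]
    refine sum_measure_failureEvent_le_lintegral hr hU fun ω => ?_
    exact_mod_cast sum_le_randomizedDecoder_ops (hb (r ω)) N fun i => U i ω
  have hW : ENNReal.ofReal (workFactor q m n k w) ≤
      ENNReal.ofReal (max (workFactor q m n k w) 0) :=
    ENNReal.ofReal_le_ofReal (le_max_left _ _)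
  refine ⟨hW.trans ?_, fun N => ?_, workFactor_eq_workFactorExplicit hq1 hw⟩
  · refine ofReal_le_of_forall_sum_le (by positivity) hguess fun N => (hops N).trans ?_
    exact lintegral_mono fun ω => le_iSup
      (fun N => ((randomizedDecoder q w T B (r ω) N fun i => U i ω).2 : ℝ≥0∞)) N
  -- Any output at all already forces a successful guess among the first `N`.
  · refine (mul_le_mul' hW (measure_mono ?_)).trans ((hguess N).trans (hops N))
    rintro ω ⟨c, -, -, h⟩ hω
    obtain ⟨l, hl, hlU⟩ := exists_mem_successSet_of_randomizedDecoder h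
    exact hω l hl hlU
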